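/- Let $\mathfrak H$ be a complex Hilbert space, let $Q$ be a bounded nonnegative selfadjoint operator in $\mathfrak H$ with $\ker Q=\{0\}$ and $\operatorname{ran}Q\neq\mathfrak H$, and let $\mathfrak M\subsetneq\mathfrak H$ be a proper closed subspace, with orthogonal projection $P_{\mathfrak M}$, such that $\mathfrak M^\perp\cap\operatorname{ran}Q=\{0\}$. Terminology. A linear operator $A$ in $\mathfrak H$ is accretive if $\operatorname{Re}(Au,u)\ge 0$ for all $u\in\operatorname{dom}A$. It is m-accretive if it is accretive, densely defined, and $\operatorname{ran}(A-\lambda I)=\mathfrak H$ for some $\lambda\in\mathbb C$ with $\operatorname{Re}\lambda<0$. It is $\alpha$-sectorial, $\alpha\in[0,\pi/2)$, if $|\arg (Au,u)|\le\alpha$ for all unit vectors $u\in\operatorname{dom}A$ (with $\arg 0=0$), and sectorial if it is $\alpha$-sectorial for some $\alpha\in[0,\pi/2)$. For an m-accretive operator $B$, $B^{1/2}$ is the unique m-accretive operator whose square, on its natural domain, is $B$; and $B^{*1/2}=(B^*)^{1/2}$, $B^{*-1/2}=(B^{*1/2})^{-1}$. Products of operators are taken on their natural domains. Then the operator $K=Q^{-1}(QP_{\mathfrak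 M}Q)^{1/2}$ is bounded and everywhere defined. Put $Z_0=iK$ and, for each integer $n\ge 1$, $$T_n=Q(I+Z_0^{2n+1}),\qquad B_n=\left(Q(I+Z_0^{2n+1})(I-Z_0^{*(2n+1)})Q\right)^{-1}.$$ For every $n\ge 1$ the following hold. 1. $T_n=(I-Z_0^{*(2n+1)})Q=Q+(-1)^n i\,QK^{2n+1}$, $T_n$ is $\frac{\pi}{4}$-sectorial, $\operatorname{Re}T_n=\frac12(T_n+T_n^*)=Q$, and $\ker T_n=\ker(I+Z_0^{2n+1})=\ker(I-Z_0^{*(2n+1)})=\{0\}$. 2. $\operatorname{ran}T_n\neq\operatorname{ran}T_n^*$. 3. $T_n^2=Q(I+Z_0^{2n+1})(I-Z_0^{*(2n+1)})Q$, and this operator is accretive and not sectorial. 4. The operator $F=T_n^{-1}T_n^*$ is m-accretive, $\operatorname{Re}(Fh,h)=0$ for all $h\in\operatorname{dom}F$, and $\operatorname{dom}F\subsetneq\operatorname{dom}F^*$. 5. If $\mathfrak M\cap\operatorname{ran}Q=\{0\}$, then $\operatorname{ran}T_n^2\cap\operatorname{ran}T_n^{*2}=\{0\}$. 6. $B_n=T_n^{-2}$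 is m-accretive and not sectorial; $B_n$ and $B_n^*$ have unique m-accretive square roots $B_n^{1/2}$, $B_n^{*1/2}$, the latter is injective, and $\operatorname{dom}B_n^{1/2}\neq\operatorname{dom}B_n^{*1/2}$. 7. The operator $F=B_n^{1/2}B_n^{*-1/2}$ is m-accretive, $\operatorname{Re}(Fh,h)=0$ for all $h\in\operatorname{dom}F$, and $\operatorname{dom}F\subsetneq\operatorname{dom}F^*$. 8. If $\mathfrak M\cap\operatorname{ran}Q=\{0\}$, then $\operatorname{dom}B_n\cap\operatorname{dom}B_n^*=\{0\}$. Moreover, the operators $B_n$, $n\ge 1$, are pairwise distinct, so they form a countably infinite family. -/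

import Mathlib

open scoped LinearPMap InnerProductSpace

namespace KatoSquareRoot

section Operators

variable {H : Type*} [NormedAddCommGroup H] [InnerProductSpace ℂ H]

/-- A bounded operator regarded as a linear operator with domain the whole space. -/
def ofBounded (T : H →L[ℂ] H) : H →ₗ.[ℂ] H :=
  (T : H →ₗ[ℂ] H).toPMap ⊤

/-- The natural domain `{f ∈ dom A : A f ∈ dom B}` of the product `B A`. -/
def prodDomain (B A : H →ₗ.[ℂ] H) : Submodule ℂ H :=
  (B.domain.comap A.toFun).map A.domain.subtype

theorem mem_prodDomain (B A : H →ₗ.[ℂ] H) (f : H) :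
    f ∈ prodDomain B A ↔ ∃ h : f ∈ A.domain, A ⟨f, h⟩ ∈ B.domain := by
  simp only [prodDomain, Submodule.mem_map, Submodule.mem_comap, Submodule.subtype_apply]
  constructor
  · rintro ⟨y, hy, rfl⟩
    exact ⟨y.2, hy⟩
  · rintro ⟨h, hA⟩
    exact ⟨⟨f, h⟩, hA, rfl⟩

theorem prod_maps_to (B A : H →ₗ.[ℂ] H) (x : (A.domRestrict (prodDomain B A)).domain) :
    A.domRestrict (prodDomain B A) x ∈ B.domain := by
  obtain ⟨h, hA⟩ := (mem_prodDomain B A x).1 x.2.1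
  rwa [LinearPMap.domRestrict_apply (f := A) (x := x) (y := ⟨x, h⟩) rfl]

/-- The product `B A` of two linear operators, `(B A) f = B (A f)`, on its natural domain
`{f ∈ dom A : A f ∈ dom B}`. -/
noncomputable def prod (B A : H →ₗ.[ℂ] H) : H →ₗ.[ℂ] H :=
  B.comp (A.domRestrict (prodDomain B A)) (prod_maps_to B A)

/-- The numerical range. Mathlib's inner product is linear in the second argument, so that
`⟪u, A u⟫_ℂ` is the number written `(A u, u)` with an inner product linear in the first. -/
def numericalRange (A : H →ₗ.[ℂ] H) : Set ℂ :=
  {z | ∃ u : A.domain, ‖(u : H)‖ = 1 ∧ z = ⟪(u : H), A u⟫_ℂ}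

/-- `Re (A u, u) ≥ 0` on the domain. -/
def IsAccretive (A : H →ₗ.[ℂ] H) : Prop :=
  ∀ u : A.domain, 0 ≤ (⟪(u : H), A u⟫_ℂ).re

/-- Accretive, densely defined, and `ran (A - λ I) = H` for some `λ` with `Re λ < 0`. -/
def IsMAccretive (A : H →ₗ.[ℂ] H) : Prop :=
  IsAccretive A ∧ Dense (A.domain : Set H) ∧
    ∃ l : ℂ, l.re < 0 ∧ ∀ g : H, ∃ u : A.domain, A u - l • (u : H) = g

/-- Sectorial with vertex `0` and semi-angle `α`. -/
def IsSectorialWith (α : ℝ) (A : H →ₗ.[ℂ] H) : Prop :=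
  numericalRange A ⊆ {z : ℂ | |z.arg| ≤ α}

/-- Sectorial with vertex `0` and some semi-angle in `[0, π/2)`. -/
def IsSectorial (A : H →ₗ.[ℂ] H) : Prop :=
  ∃ α : ℝ, 0 ≤ α ∧ α < Real.pi / 2 ∧ IsSectorialWith α A

/-- `S` is an m-accretive square root of `A`: it is m-accretive and `S S = A`, domains included. -/
def IsMAccretiveSqrt (A S : H →ₗ.[ℂ] H) : Prop :=
  IsMAccretive S ∧ prod S S = A

/-- `Re (F h, h) = 0` on the domain of `F`. -/
def HasZeroRealPart (F : H →ₗ.[ℂ] H) : Prop :=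
  ∀ h : F.domain, (⟪(h : H), F h⟫_ℂ).re = 0

end Operators

section Construction

variable {H : Type*} [NormedAddCommGroup H] [InnerProductSpace ℂ H] [CompleteSpace H]

/-- The operator `Q⁻¹ (Q P_M Q)^{1/2}`, on its natural domain. -/
noncomputable def quotientOp (Q : H →L[ℂ] H) (M : Submodule ℂ H) [M.HasOrthogonalProjection] :
    H →ₗ.[ℂ] H :=
  prod (ofBounded Q).inverse (ofBounded (CFC.sqrt (Q * M.starProjection * Q)))

/-- `T_n = Q (I + Z ^ (2n+1))`. -/
noncomputable def rootOp (Q Z : H →L[ℂ] H) (n : ℕ) : H →L[ℂ] H :=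
  Q * (1 + Z ^ (2 * n + 1))

/-- `Q (I + Z ^ (2n+1)) (I - Z* ^ (2n+1)) Q`. -/
noncomputable def squareOp (Q Z : H →L[ℂ] H) (n : ℕ) : H →L[ℂ] H :=
  Q * (1 + Z ^ (2 * n + 1)) * (1 - star Z ^ (2 * n + 1)) * Q

/-- `B_n = (Q (I + Z ^ (2n+1)) (I - Z* ^ (2n+1)) Q)⁻¹`. -/
noncomputable def katoOp (Q Z : H →L[ℂ] H) (n : ℕ) : H →ₗ.[ℂ] H :=
  (ofBounded (squareOp Q Z n)).inverse

end Construction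

end KatoSquareRoot

namespace KatoSquareRoot

/-! ### Operators through their graphs; sectoriality estimates -/

section Graphs

variable {H : Type*} [NormedAddCommGroup H] [InnerProductSpace ℂ H]

/-! Everything reduces to a nonunitary isometry V with Q V = -V* Q (`IsSkewPair`). Let P be the
projection onto M and S = (Q P Q)^{1/2}. Then ‖S x‖ = ‖P Q x‖ ≤ ‖Q x‖, so S factors as Q K = K* Q
with K bounded; K K* = P, and M^⊥ ∩ ran Q = {0} makes S injective and hence K an isometry
(`exists_isometric_factor`). An odd power V of iK is again an isometry, and its scalar ±i turns Q
K^m = K*^m Q into the skew relation. It is not unitary, since M^⊥ lies in ker V*.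

Put T = Q(1+V) = (1-V*)Q, so T* = Q(1-V) and Re T = Q. The angle π/4 comes from operator
monotonicity of the square root: R = -iQV is selfadjoint with R² = Q V V* Q ≤ Q², whence ±R ≤ Q.
With y = Qu, the form of T² has real part ‖y‖² - ‖V* y‖² ≥ 0; it vanishes on ran V, where a
sectorial form would have to vanish entirely, and that would make V selfadjoint, hence unitary. The
quotient T⁻¹T* is the Cayley transform (1-V)(1+V)⁻¹, whose adjoint has a larger domain because ker
V* is nonzero.

The claims about B = T⁻² need the square roots of B and B* identified as T⁻¹ and T*⁻¹. This is
`isMAccretiveSqrt_inverse_iff`, resting on the iteration in `accretive_sqrt_unique`. The same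
uniqueness separates the members of the family (`injective_katoOp`). -/

theorem linearPMap_eq_iff {A B : H →ₗ.[ℂ] H} :
    A = B ↔ ∀ x y, (x, y) ∈ A.graph ↔ (x, y) ∈ B.graph := by
  refine ⟨fun h => by simp [h], fun h => LinearPMap.eq_of_eq_graph ?_⟩
  ext ⟨x, y⟩
  exact h x y

theorem mem_graph_ofBounded {T : H →L[ℂ] H} {x y : H} :
    (x, y) ∈ (ofBounded T).graph ↔ T x = y := by
  rw [LinearPMap.mem_graph_iff]
  constructor
  · rintro ⟨u, rfl, rfl⟩
    rfl
  · rintro rfl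
    exact ⟨⟨x, trivial⟩, rfl, rfl⟩

theorem mem_graph_inverse {A : H →ₗ.[ℂ] H} (hA : A.toFun.ker = ⊥) {x y : H} :
    (x, y) ∈ A.inverse.graph ↔ (y, x) ∈ A.graph := by
  rw [LinearPMap.inverse_graph hA]
  constructor
  · rintro ⟨⟨a, b⟩, h, h'⟩
    obtain ⟨rfl, rfl⟩ := Prod.mk.inj h'
    exact h
  · exact fun h => ⟨(y, x), h, rfl⟩

theorem ker_toFun_eq_bot {A : H →ₗ.[ℂ] H} (h : ∀ x, (x, 0) ∈ A.graph → x = 0) :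
    A.toFun.ker = ⊥ := by
  rw [LinearMap.ker_eq_bot']
  rintro ⟨x, hx⟩ h0
  have := h x (by rw [← h0]; exact A.mem_graph ⟨x, hx⟩)
  exact Subtype.ext this

theorem ker_eq_bot_of_forall {T : H →L[ℂ] H} (h : ∀ x, T x = 0 → x = 0) : T.ker = ⊥ :=
  LinearMap.ker_eq_bot'.2 h

theorem eq_zero_of_ker {T : H →L[ℂ] H} (h : T.ker = ⊥) {x : H} (hx : T x = 0) : x = 0 :=
  LinearMap.ker_eq_bot'.1 h x hx

theorem ker_ofBounded {T : H →L[ℂ] H} (h : T.ker = ⊥) : (ofBounded T).toFun.ker = ⊥ :=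
  ker_toFun_eq_bot fun _ hx => eq_zero_of_ker h (mem_graph_ofBounded.1 hx)

theorem mem_graph_inverse_ofBounded {T : H →L[ℂ] H} (h : T.ker = ⊥) {x y : H} :
    (x, y) ∈ (ofBounded T).inverse.graph ↔ T y = x := by
  rw [mem_graph_inverse (ker_ofBounded h), mem_graph_ofBounded]

theorem ker_inverse_ofBounded {T : H →L[ℂ] H} (h : T.ker = ⊥) :
    (ofBounded T).inverse.toFun.ker = ⊥ :=
  ker_toFun_eq_bot fun x hx => by
    rw [mem_graph_inverse_ofBounded h, map_zero] at hx
    exact hx.symm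

theorem inverse_inverse_ofBounded {T : H →L[ℂ] H} (h : T.ker = ⊥) :
    (ofBounded T).inverse.inverse = ofBounded T := by
  rw [linearPMap_eq_iff]
  intro x y
  rw [mem_graph_inverse (ker_inverse_ofBounded h), mem_graph_inverse_ofBounded h,
    mem_graph_ofBounded]

theorem domain_inverse_ofBounded (T : H →L[ℂ] H) : (ofBounded T).inverse.domain = T.range := by
  rw [LinearPMap.inverse_domain]
  ext x
  constructor
  · rintro ⟨u, rfl⟩
    exact ⟨u, rfl⟩
  · rintro ⟨u, rfl⟩
    exact ⟨⟨u, trivial⟩, rfl⟩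

theorem mem_graph_prod {B A : H →ₗ.[ℂ] H} {x z : H} :
    (x, z) ∈ (prod B A).graph ↔ ∃ y, (x, y) ∈ A.graph ∧ (y, z) ∈ B.graph := by
  constructor
  · rw [LinearPMap.mem_graph_iff]
    rintro ⟨⟨u, hu⟩, rfl, rfl⟩
    obtain ⟨h, hA⟩ := (mem_prodDomain B A u).1 hu.1
    exact ⟨A ⟨u, h⟩, A.mem_graph ⟨u, h⟩, B.mem_graph ⟨_, hA⟩⟩
  · rintro ⟨y, h1, h2⟩
    rw [LinearPMap.mem_graph_iff] at h1 h2
    obtain ⟨⟨u, hu⟩, rfl, rfl⟩ := h1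
    obtain ⟨⟨v, hv⟩, hvv, rfl⟩ := h2
    change v = A ⟨u, hu⟩ at hvv
    subst hvv
    rw [LinearPMap.mem_graph_iff]
    exact ⟨⟨u, (mem_prodDomain B A u).2 ⟨hu, hv⟩, hu⟩, rfl, rfl⟩

theorem isAccretive_iff {A : H →ₗ.[ℂ] H} :
    IsAccretive A ↔ ∀ x y, (x, y) ∈ A.graph → 0 ≤ (⟪x, y⟫_ℂ).re := by
  constructor
  · intro h x y hxy
    rw [LinearPMap.mem_graph_iff] at hxy
    obtain ⟨u, rfl, rfl⟩ := hxy
    exact h u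
  · exact fun h u => h _ _ (A.mem_graph u)

theorem hasZeroRealPart_iff {A : H →ₗ.[ℂ] H} :
    HasZeroRealPart A ↔ ∀ x y, (x, y) ∈ A.graph → (⟪x, y⟫_ℂ).re = 0 := by
  constructor
  · intro h x y hxy
    rw [LinearPMap.mem_graph_iff] at hxy
    obtain ⟨u, rfl, rfl⟩ := hxy
    exact h u
  · exact fun h u => h _ _ (A.mem_graph u)

theorem HasZeroRealPart.isAccretive {A : H →ₗ.[ℂ] H} (h : HasZeroRealPart A) : IsAccretive A :=
  fun u => (h u).ge

theorem mem_numericalRange {A : H →ₗ.[ℂ] H} {z : ℂ} :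
    z ∈ numericalRange A ↔ ∃ x y, (x, y) ∈ A.graph ∧ ‖x‖ = 1 ∧ z = ⟪x, y⟫_ℂ := by
  constructor
  · rintro ⟨u, hu, rfl⟩
    exact ⟨u, A u, A.mem_graph u, hu, rfl⟩
  · rintro ⟨x, y, hxy, hx, rfl⟩
    rw [LinearPMap.mem_graph_iff] at hxy
    obtain ⟨u, rfl, rfl⟩ := hxy
    exact ⟨u, hx, rfl⟩

/-- A sectorial operator dominates its form by the real part. -/
theorem IsSectorial.exists_norm_le {A : H →ₗ.[ℂ] H} (h : IsSectorial A) :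
    ∃ c : ℝ, 0 < c ∧ ∀ x y, (x, y) ∈ A.graph → c * ‖⟪x, y⟫_ℂ‖ ≤ (⟪x, y⟫_ℂ).re := by
  obtain ⟨α, h0, h1, h⟩ := h
  -- Re z = ‖z‖ cos (arg z), and cosine decreases on [0, π].
  refine ⟨Real.cos α, Real.cos_pos_of_mem_Ioo ⟨by linarith [Real.pi_pos], h1⟩, fun x y hxy => ?_⟩
  rcases eq_or_ne x 0 with rfl | hx
  · simp
  have hx' : 0 < ‖x‖ := norm_pos_iff.2 hx
  -- The numerical range sees unit vectors only; the positive factor c² does not change the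
  -- argument.
  set c : ℝ := ‖x‖⁻¹ with hc
  have hc0 : 0 < c := inv_pos.2 hx'
  have hmem : ((c : ℂ) • x, (c : ℂ) • y) ∈ A.graph := A.graph.smul_mem (c : ℂ) hxy
  have hz : ⟪(c : ℂ) • x, (c : ℂ) • y⟫_ℂ = ((c ^ 2 : ℝ) : ℂ) * ⟪x, y⟫_ℂ := by
    rw [inner_smul_left, inner_smul_right, Complex.conj_ofReal]
    push_cast
    ring
  have harg : |(⟪(c : ℂ) • x, (c : ℂ) • y⟫_ℂ).arg| ≤ α :=
    h (mem_numericalRange.2 ⟨_, _, hmem, by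
      rw [norm_smul, Complex.norm_real, Real.norm_of_nonneg hc0.le, hc, inv_mul_cancel₀ hx'.ne'],
      rfl⟩)
  rw [hz, Complex.arg_real_mul _ (by positivity)] at harg
  rw [← Complex.norm_mul_cos_arg ⟪x, y⟫_ℂ, mul_comm, ← Real.cos_abs (Complex.arg _)]
  exact mul_le_mul_of_nonneg_left
    (Real.cos_le_cos_of_nonneg_of_le_pi (abs_nonneg _) (by linarith [Real.pi_pos]) harg)
    (norm_nonneg _)

theorem abs_arg_le_pi_div_four {z : ℂ} (h : |z.im| ≤ z.re) : |z.arg| ≤ Real.pi / 4 := by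
  have hre : 0 ≤ z.re := (abs_nonneg _).trans h
  rcases hre.eq_or_lt with h0 | h0
  · have : z = 0 := by
      apply Complex.ext
      · exact h0.symm
      · rw [← h0] at h
        exact abs_nonpos_iff.1 h
    rw [this, Complex.arg_zero, abs_zero]
    positivity
  · rw [abs_le] at h
    have ht : z.arg = Real.arctan (z.im / z.re) := by
      rw [← Complex.tan_arg, Real.arctan_tan]
      · exact (abs_lt.1 (Complex.abs_arg_lt_pi_div_two_iff.2 (Or.inl h0))).1
      · exact (abs_lt.1 (Complex.abs_arg_lt_pi_div_two_iff.2 (Or.inl h0))).2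
    rw [ht, abs_le]
    constructor
    · rw [← Real.arctan_one, ← Real.arctan_neg]
      apply Real.arctan_mono
      rw [le_div_iff₀ h0]
      linarith
    · rw [← Real.arctan_one]
      apply Real.arctan_mono
      rw [div_le_iff₀ h0]
      linarith

end Graphs

/-! ### Uniqueness of m-accretive square roots -/

section SquareRoots

variable {H : Type*} [NormedAddCommGroup H] [InnerProductSpace ℂ H]

/-- Adding a positive multiple of the identity to an accretive operator bounds it below. -/
theorem norm_add_smul_ge {u v : H} (h : 0 ≤ (⟪u, v⟫_ℂ).re) {s : ℝ} (hs : 0 ≤ s) :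
    s * ‖u‖ ≤ ‖(s : ℂ) • u + v‖ := by
  have h1 : ‖(s : ℂ) • u + v‖ ^ 2 = s ^ 2 * ‖u‖ ^ 2 + 2 * (s * (⟪u, v⟫_ℂ).re) + ‖v‖ ^ 2 := by
    rw [@norm_add_sq ℂ, inner_smul_left, Complex.conj_ofReal, norm_smul, Complex.norm_real,
      Real.norm_of_nonneg hs, mul_pow]
    simp
  refine le_of_sq_le_sq ?_ (norm_nonneg _)
  rw [h1, mul_pow]
  nlinarith [mul_nonneg hs h, sq_nonneg ‖v‖]

/-- With E = 1 - T/C, the hypothesis yields ‖E u‖² ≤ ‖u‖² - C⁻¹ Re (T u, u). Hence ‖T E^k v‖² is at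
most C² times the k-th decrement of the decreasing sequence ‖E^k v‖², and these decrements tend to
0. -/
theorem tendsto_norm_comp_pow {T : H →L[ℂ] H} {C : ℝ} (hC : 0 < C)
    (hT : ∀ u, ‖T u‖ ^ 2 ≤ C * (⟪u, T u⟫_ℂ).re) (v : H) :
    Filter.Tendsto (fun k : ℕ => ‖T (((1 - ((C⁻¹ : ℝ) : ℂ) • T : H →L[ℂ] H) ^ k) v)‖)
      Filter.atTop (nhds 0) := by
  set E : H →L[ℂ] H := 1 - ((C⁻¹ : ℝ) : ℂ) • T with hE
  have hstep : ∀ u, ‖E u‖ ^ 2 ≤ ‖u‖ ^ 2 - C⁻¹ * (⟪u, T u⟫_ℂ).re := by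
    intro u
    have h1 : ‖E u‖ ^ 2 = ‖u‖ ^ 2 - 2 * (C⁻¹ * (⟪u, T u⟫_ℂ).re) + C⁻¹ ^ 2 * ‖T u‖ ^ 2 := by
      have : E u = u - ((C⁻¹ : ℝ) : ℂ) • T u := by simp [hE]
      rw [this, @norm_sub_sq ℂ, inner_smul_right, norm_smul, Complex.norm_real,
        Real.norm_of_nonneg (inv_pos.2 hC).le, mul_pow]
      simp only [RCLike.re_to_complex, Complex.re_ofReal_mul]
    have h2 : C⁻¹ ^ 2 * ‖T u‖ ^ 2 ≤ C⁻¹ * (⟪u, T u⟫_ℂ).re := by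
      calc C⁻¹ ^ 2 * ‖T u‖ ^ 2 ≤ C⁻¹ ^ 2 * (C * (⟪u, T u⟫_ℂ).re) := by
            gcongr
            exact hT u
        _ = C⁻¹ * (⟪u, T u⟫_ℂ).re := by field_simp
    linarith
  have hbound : ∀ k, ‖T ((E ^ k) v)‖ ^ 2 ≤
      C ^ 2 * (‖(E ^ k) v‖ ^ 2 - ‖(E ^ (k + 1)) v‖ ^ 2) := by
    intro k
    have h1 := hT ((E ^ k) v)
    have h2 := hstep ((E ^ k) v)
    have h3 : (E ^ (k + 1)) v = E ((E ^ k) v) := by rw [pow_succ']; rfl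
    rw [h3]
    calc _ ≤ _ := h1
      _ = C ^ 2 * (C⁻¹ * (⟪(E ^ k) v, T ((E ^ k) v)⟫_ℂ).re) := by field_simp
      _ ≤ _ := by
        gcongr
        linarith
  have hnonneg : ∀ u, 0 ≤ (⟪u, T u⟫_ℂ).re := fun u =>
    nonneg_of_mul_nonneg_right ((sq_nonneg _).trans (hT u)) hC
  have hanti : Antitone fun k => ‖(E ^ k) v‖ ^ 2 := antitone_nat_of_succ_le fun k => by
    have h3 : (E ^ (k + 1)) v = E ((E ^ k) v) := by rw [pow_succ']; rfl
    rw [h3]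
    have := hstep ((E ^ k) v)
    have := mul_nonneg (inv_pos.2 hC).le (hnonneg ((E ^ k) v))
    linarith
  have hlim := tendsto_atTop_ciInf hanti ⟨0, by rintro _ ⟨k, rfl⟩; positivity⟩
  have hdiff := (hlim.sub (hlim.comp (Filter.tendsto_add_atTop_nat 1))).const_mul (C ^ 2)
  rw [sub_self, mul_zero] at hdiff
  have hsq := squeeze_zero (fun k => sq_nonneg _) hbound hdiff
  have := hsq.sqrt
  simpa [Real.sqrt_sq (norm_nonneg _)] using this

/-- Bounded accretive square roots of `T ^ 2` are equal to `T` when `T` is sectorial with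
dense range. -/
theorem accretive_sqrt_unique {T X : H →L[ℂ] H} {C : ℝ} (hC : 0 < C)
    (hT : ∀ u, ‖T u‖ ^ 2 ≤ C * (⟪u, T u⟫_ℂ).re) (hd : DenseRange T)
    (hX : ∀ u, 0 ≤ (⟪u, X u⟫_ℂ).re) (hXT : X * X = T * T) : X = T := by
  set E : H →L[ℂ] H := 1 - ((C⁻¹ : ℝ) : ℂ) • T with hE
  set D : H →L[ℂ] H := X - T with hD
  have hXD : X * D = -(D * T) := by
    rw [hD, mul_sub, sub_mul, hXT]
    abel
  have hCC : (C : ℂ) * ((C⁻¹ : ℝ) : ℂ) = 1 := by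
    rw [← Complex.ofReal_mul, mul_inv_cancel₀ hC.ne', Complex.ofReal_one]
  -- From X D = -D T one gets (C + X) D = D (C - T) = C D E, and accretivity of X bounds C + X below
  -- by C.
  have hstep : ∀ u, ‖D u‖ ≤ ‖D (E u)‖ := by
    intro u
    have h1 := norm_add_smul_ge (hX (D u)) hC.le
    have h2 : X (D u) = -D (T u) := congrArg (fun A : H →L[ℂ] H => A u) hXD
    have h3 : (C : ℂ) • D u + X (D u) = (C : ℂ) • D (E u) := by
      simp only [hE, sub_apply, one_apply_eq_self, map_sub, smul_sub, smul_apply, map_smul,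
        smul_smul, hCC, one_smul, h2]
      abel
    rw [h3, norm_smul, Complex.norm_real, Real.norm_of_nonneg hC.le] at h1
    exact le_of_mul_le_mul_left h1 hC
  have hiter : ∀ k u, ‖D u‖ ≤ ‖D ((E ^ k) u)‖ := by
    intro k
    induction k with
    | zero => simp
    | succ k ih =>
      intro u
      refine (ih u).trans ((hstep _).trans_eq ?_)
      rw [pow_succ']
      rfl
  have hcomm : ∀ k, E ^ k * T = T * E ^ k := fun k => by
    have : Commute E T := by
      rw [hE]
      exact (Commute.one_left T).sub_left ((Commute.refl T).smul_left _)
    exact this.pow_left k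
  -- Since E commutes with T, ‖D T v‖ ≤ ‖D E^k T v‖ ≤ ‖D‖ ‖T E^k v‖, which tends to 0.
  have hDT : ∀ v, D (T v) = 0 := by
    intro v
    have hlim := (tendsto_norm_comp_pow hC hT v).const_mul ‖D‖
    rw [mul_zero] at hlim
    refine norm_le_zero_iff.1 (ge_of_tendsto' hlim fun k => (hiter k (T v)).trans ?_)
    have : (E ^ k) (T v) = T ((E ^ k) v) := congrArg (fun A : H →L[ℂ] H => A v) (hcomm k)
    rw [this]
    exact D.le_opNorm _
  have hD0 : (D : H → H) = fun _ => 0 :=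
    hd.equalizer D.continuous continuous_const (funext hDT)
  have : D = 0 := by
    ext u
    exact congrFun hD0 u
  exact sub_eq_zero.1 this

/-- S - l is onto and bounded below by -Re l. Solving (S - l) u = g₀ - l x₀ and comparing with (x k,
g k) forces x k → u, so the limit point is (u, S u). -/
theorem isMAccretive_isClosed_graph {S : H →ₗ.[ℂ] H} (hS : IsMAccretive S) {x g : ℕ → H}
    {x₀ g₀ : H} (hx : Filter.Tendsto x Filter.atTop (nhds x₀))
    (hg : Filter.Tendsto g Filter.atTop (nhds g₀)) (h : ∀ k, (x k, g k) ∈ S.graph) :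
    (x₀, g₀) ∈ S.graph := by
  obtain ⟨hacc, -, l, hl, hsurj⟩ := hS
  rw [isAccretive_iff] at hacc
  obtain ⟨u, hu⟩ := hsurj (g₀ - l • x₀)
  have hbd : ∀ k, -l.re * ‖x k - u‖ ≤ ‖(g k - l • x k) - (g₀ - l • x₀)‖ := by
    intro k
    have h1 := hacc _ _ (S.graph.sub_mem (h k) (S.mem_graph u))
    set s : ℝ := -l.re with hs
    set v : H := g k - S u
    set w : H := x k - u
    -- The imaginary part of l adds a skew term, so only Re l enters the lower bound.
    have h2 : (⟪w, v - (Complex.I * l.im) • w⟫_ℂ).re = (⟪w, v⟫_ℂ).re := by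
      rw [inner_sub_right, inner_smul_right, inner_self_eq_norm_sq_to_K]
      simp [← Complex.ofReal_pow]
    have h3 := norm_add_smul_ge (h1.trans_eq h2.symm) (show 0 ≤ s by linarith)
    have h4 : (s : ℂ) • w + (v - (Complex.I * l.im) • w) = v - l • w := by
      conv_rhs => rw [← Complex.re_add_im l]
      rw [hs]
      push_cast
      module
    rw [h4] at h3
    convert h3 using 2
    rw [← hu]
    simp only [v, w]
    module
  have hlim : Filter.Tendsto (fun k => -l.re * ‖x k - u‖) Filter.atTop (nhds 0) := by
    refine squeeze_zero (fun k => mul_nonneg (by linarith) (norm_nonneg _)) hbd ?_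
    have := ((hg.sub (hx.const_smul l)).sub_const (g₀ - l • x₀)).norm
    simpa using this
  have hlim2 : Filter.Tendsto (fun k => -l.re * ‖x k - u‖) Filter.atTop
      (nhds (-l.re * ‖x₀ - u‖)) := ((hx.sub_const _).norm).const_mul _
  have h0 := tendsto_nhds_unique hlim hlim2
  have hxu : x₀ = u := by
    rcases mul_eq_zero.1 h0.symm with h | h
    · linarith
    · exact sub_eq_zero.1 (norm_eq_zero.1 h)
  have hgu : g₀ = S u := by
    rw [← hxu] at hu
    exact (sub_left_inj.1 hu).symm
  rw [hxu, hgu]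
  exact S.mem_graph u

/-- For l = -1 the range condition asks for x with A⁻¹ x + x = g. Accretivity makes 1 + A
invertible; take x = A u with (1 + A) u = g. -/
theorem isMAccretive_inverse_ofBounded [CompleteSpace H] {A : H →L[ℂ] H} (hker : A.ker = ⊥)
    (hd : DenseRange A) (hA : ∀ u, 0 ≤ (⟪u, A u⟫_ℂ).re) :
    IsMAccretive (ofBounded A).inverse := by
  refine ⟨isAccretive_iff.2 fun x y hxy => ?_, ?_, -1, by simp, fun g => ?_⟩
  · rw [mem_graph_inverse_ofBounded hker] at hxy
    rw [← hxy, ← inner_conj_symm, Complex.conj_re]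
    exact hA y
  · rw [domain_inverse_ofBounded]
    exact hd
  · have hunit : IsUnit (1 + A) := by
      refine ContinuousLinearMap.isUnit_of_forall_le_norm_inner_map (1 + A) (c := 1) one_pos
        fun x => ?_
      rw [NNReal.coe_one, mul_one]
      refine le_trans ?_ (Complex.re_le_norm _)
      rw [← inner_conj_symm, Complex.conj_re, add_apply, inner_add_right,
        Complex.add_re, one_apply_eq_self, inner_self_eq_norm_sq_to_K]
      have := hA x
      simpa [← Complex.ofReal_pow] using this
    obtain ⟨u, hu⟩ := ((ContinuousLinearMap.isUnit_iff_bijective).1 hunit).2 g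
    have hm : (A u, u) ∈ (ofBounded A).inverse.graph := (mem_graph_inverse_ofBounded hker).2 rfl
    rw [LinearPMap.mem_graph_iff] at hm
    obtain ⟨w, hw1, hw2⟩ := hm
    refine ⟨w, ?_⟩
    change (w : H) = A u at hw1
    change _ = u at hw2
    rw [hw1, hw2, ← hu]
    simp

/-- The inverse of a bounded operator `T` with `‖T u‖ ^ 2 ≤ C Re (T u, u)` is the only
m-accretive square root of the inverse of `T ^ 2`. -/
theorem isMAccretiveSqrt_inverse_iff [CompleteSpace H] {T : H →L[ℂ] H} {C : ℝ} (hC : 0 < C)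
    (hT : ∀ u, ‖T u‖ ^ 2 ≤ C * (⟪u, T u⟫_ℂ).re) (hd : DenseRange T) (hker : T.ker = ⊥)
    {A : H →L[ℂ] H} (hA : A = T * T) {S : H →ₗ.[ℂ] H} :
    IsMAccretiveSqrt (ofBounded A).inverse S ↔ S = (ofBounded T).inverse := by
  have hkerA : A.ker = ⊥ := ker_eq_bot_of_forall fun x hx => by
    rw [hA] at hx
    exact eq_zero_of_ker hker (eq_zero_of_ker hker hx)
  constructor
  · rintro ⟨hS, hSS⟩
    rw [linearPMap_eq_iff] at hSS
    have hSS' : ∀ x z, (∃ y, (x, y) ∈ S.graph ∧ (y, z) ∈ S.graph) ↔ A z = x := fun x z => by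
      rw [← mem_graph_prod, hSS, mem_graph_inverse_ofBounded hkerA]
    have hinj : ∀ x, (x, 0) ∈ S.graph → x = 0 := fun x hx => by
      have := (hSS' x 0).1 ⟨0, hx, S.graph.zero_mem⟩
      rw [← this, map_zero]
    have hbij : Function.Bijective S.toFun := by
      refine ⟨LinearMap.ker_eq_bot.1 (ker_toFun_eq_bot hinj), fun g => ?_⟩
      obtain ⟨y, -, hy⟩ := (hSS' (A g) g).2 rfl
      rw [LinearPMap.mem_graph_iff] at hy
      obtain ⟨u, -, hu⟩ := hy
      exact ⟨u, hu⟩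
    -- S is bijective because S² is the inverse of an everywhere defined operator; the closed graph
    -- theorem then makes its inverse X bounded, with X² = T².
    let e := LinearEquiv.ofBijective S.toFun hbij
    let X₀ : H →ₗ[ℂ] H := S.domain.subtype ∘ₗ e.symm.toLinearMap
    have hX₀ : ∀ g, (X₀ g, g) ∈ S.graph := fun g => by
      have := S.mem_graph (e.symm g)
      rwa [show S (e.symm g) = g from e.apply_symm_apply g] at this
    have hX₀' : ∀ x g, (x, g) ∈ S.graph → x = X₀ g := fun x g h => by
      have h1 := S.graph.sub_mem h (hX₀ g)
      rw [Prod.mk_sub_mk, sub_self] at h1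
      exact sub_eq_zero.1 (hinj _ h1)
    let X : H →L[ℂ] H := ⟨X₀, X₀.continuous_of_seq_closed_graph fun g x y hg hx =>
      hX₀' _ _ (isMAccretive_isClosed_graph hS hx hg fun k => hX₀ _)⟩
    have hXT : X = T := by
      refine accretive_sqrt_unique hC hT hd (fun u => ?_) ?_
      · rw [← inner_conj_symm, Complex.conj_re]
        exact isAccretive_iff.1 hS.1 _ _ (hX₀ u)
      · rw [← hA]
        ext g
        exact ((hSS' _ _).1 ⟨_, hX₀ _, hX₀ g⟩).symm
    rw [linearPMap_eq_iff]
    intro x y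
    rw [mem_graph_inverse_ofBounded hker, ← hXT]
    exact ⟨fun h => (hX₀' _ _ h).symm, fun h => h ▸ hX₀ y⟩
  · rintro rfl
    refine ⟨isMAccretive_inverse_ofBounded hker hd fun u =>
      nonneg_of_mul_nonneg_right ((sq_nonneg _).trans (hT u)) hC, ?_⟩
    rw [linearPMap_eq_iff]
    intro x y
    rw [mem_graph_inverse_ofBounded hkerA, hA]
    simp only [mem_graph_prod, mem_graph_inverse_ofBounded hker]
    exact ⟨fun ⟨z, h1, h2⟩ => by rw [← h1, ← h2]; rfl, fun h => ⟨T y, h, rfl⟩⟩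

end SquareRoots

/-! ### Adjoints of inverses of bounded operators -/

section Adjoints

variable {H : Type*} [NormedAddCommGroup H] [InnerProductSpace ℂ H] [CompleteSpace H]

theorem denseRange_of_ker_star {T : H →L[ℂ] H} (h : (star T).ker = ⊥) : DenseRange T := by
  have h1 : T.rangeᗮ = ⊥ := by
    rw [ContinuousLinearMap.orthogonal_range]
    exact h
  exact (Submodule.dense_iff_topologicalClosure_eq_top (s := T.range)).2
    ((Submodule.topologicalClosure_eq_top_iff).2 h1)

theorem mem_graph_adjoint {B : H →ₗ.[ℂ] H} (hB : Dense (B.domain : Set H)) {x w : H} :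
    (x, w) ∈ B†.graph ↔ ∀ y z, (y, z) ∈ B.graph → ⟪w, y⟫_ℂ = ⟪x, z⟫_ℂ := by
  constructor
  · intro h y z hyz
    rw [LinearPMap.mem_graph_iff] at h hyz
    obtain ⟨u, rfl, rfl⟩ := h
    obtain ⟨v, rfl, rfl⟩ := hyz
    exact LinearPMap.adjoint_isFormalAdjoint hB u v
  · intro h
    have h' : ∀ v : B.domain, ⟪w, (v : H)⟫_ℂ = ⟪x, B v⟫_ℂ := fun v => h _ _ (B.mem_graph v)
    have hx : x ∈ B†.domain := LinearPMap.mem_adjoint_domain_of_exists x ⟨w, h'⟩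
    rw [LinearPMap.mem_graph_iff]
    exact ⟨⟨x, hx⟩, rfl, LinearPMap.adjoint_apply_eq hB ⟨x, hx⟩ h'⟩

theorem adjoint_inverse_ofBounded {A : H →L[ℂ] H} (h : A.ker = ⊥) (h' : (star A).ker = ⊥) :
    (ofBounded A).inverse† = (ofBounded (star A)).inverse := by
  rw [linearPMap_eq_iff]
  intro x w
  have hd : Dense ((ofBounded A).inverse.domain : Set H) := by
    rw [domain_inverse_ofBounded]
    exact denseRange_of_ker_star h'
  rw [mem_graph_adjoint hd, mem_graph_inverse_ofBounded h']
  simp only [mem_graph_inverse_ofBounded h]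
  constructor
  · intro hw
    refine ext_inner_right ℂ fun z => ?_
    rw [ContinuousLinearMap.star_eq_adjoint, ContinuousLinearMap.adjoint_inner_left]
    exact hw _ z rfl
  · rintro rfl y z rfl
    rw [ContinuousLinearMap.star_eq_adjoint, ContinuousLinearMap.adjoint_inner_left]

end Adjoints

/-! ### Skew pairs and their roots Q(1+V) -/

section SkewPairs

variable {H : Type*} [NormedAddCommGroup H] [InnerProductSpace ℂ H] [CompleteSpace H]

/-- A nonnegative injective operator `Q` and a nonunitary isometry `V` with `Q V = -V* Q`. -/
structure IsSkewPair (Q V : H →L[ℂ] H) : Prop where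
  isPositive : Q.IsPositive
  ker_eq_bot : Q.ker = ⊥
  star_mul_self : star V * V = 1
  mul_eq : Q * V = -(star V * Q)
  exists_star_apply_eq_zero : ∃ x, x ≠ 0 ∧ star V x = 0

theorem inner_apply_eq_star (T : H →L[ℂ] H) (x y : H) : ⟪x, T y⟫_ℂ = ⟪star T x, y⟫_ℂ := by
  rw [ContinuousLinearMap.star_eq_adjoint, ContinuousLinearMap.adjoint_inner_left]

theorem inner_star_apply_eq (T : H →L[ℂ] H) (x y : H) : ⟪x, star T y⟫_ℂ = ⟪T x, y⟫_ℂ := by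
  rw [inner_apply_eq_star, star_star]

/-- With s = Q^{1/2}: Q u = s (s u), Re (Q u, u) = ‖s u‖² and ‖s‖² = ‖Q‖. -/
theorem norm_sq_apply_le_of_isPositive {Q : H →L[ℂ] H} (hQ : Q.IsPositive) (u : H) :
    ‖Q u‖ ^ 2 ≤ ‖Q‖ * (⟪u, Q u⟫_ℂ).re := by
  have h0 : 0 ≤ Q := (ContinuousLinearMap.nonneg_iff_isPositive Q).2 hQ
  set s := CFC.sqrt Q with hs
  have hss : s * s = Q := CFC.sqrt_mul_sqrt_self Q
  have hsa : star s = s := (CFC.sqrt_nonneg Q).isSelfAdjoint.star_eq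
  have h1 : (⟪u, Q u⟫_ℂ).re = ‖s u‖ ^ 2 := by
    rw [← hss, mul_apply_eq_comp, inner_apply_eq_star, hsa,
      inner_self_eq_norm_sq_to_K]
    simp [← Complex.ofReal_pow]
  have h2 : ‖Q u‖ ≤ ‖s‖ * ‖s u‖ := by
    rw [← hss]
    exact s.le_opNorm _
  have h3 : ‖s‖ ^ 2 = ‖Q‖ := by
    rw [← hss, sq, ← CStarRing.norm_star_mul_self, hsa]
  rw [h1, ← h3, ← mul_pow]
  gcongr

omit [CompleteSpace H] in
-- Parametrizes the graph of the Cayley transform of V; the parameter must be half of x + y because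
-- (1 + V) u + (1 - V) u = 2u.
theorem exists_eq_one_add_eq_one_sub {V : H →L[ℂ] H} {x y : H} (hxy : (1 + V) y = (1 - V) x) :
    ∃ u, x = (1 + V) u ∧ y = (1 - V) u := by
  have hxy' : y + V y = x - V x := hxy
  refine ⟨(1 / 2 : ℂ) • (x + y), ?_, ?_⟩
  · simp only [add_apply, one_apply_eq_self, map_smul, map_add]
    rw [show V x = x - (y + V y) by rw [hxy']; abel]
    module
  · simp only [sub_apply, one_apply_eq_self, map_smul, map_add]
    rw [show V x = x - (y + V y) by rw [hxy']; abel]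
    module

/-- A selfadjoint `R` with `R ^ 2 ≤ Q ^ 2` satisfies `R ≤ Q`. -/
theorem le_of_sq_le_sq_of_isSelfAdjoint {Q R : H →L[ℂ] H} (hQ : 0 ≤ Q) (hR : IsSelfAdjoint R)
    (h : R * R ≤ Q * Q) : R ≤ Q := by
  have h1 : CFC.abs R ≤ Q := by
    have := CFC.sqrt_le_sqrt _ _ h
    rwa [CFC.sqrt_mul_self Q hQ, show CFC.sqrt (R * R) = CFC.abs R by
      rw [CFC.abs, hR.star_eq]] at this
  refine le_trans ?_ h1
  rw [← sub_nonneg, CFC.abs_sub_self R hR]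
  exact smul_nonneg zero_le_two (CFC.negPart_nonneg R)

namespace IsSkewPair

variable {Q V : H →L[ℂ] H} (h : IsSkewPair Q V)
include h

/-- Passing from V to -V replaces the root by its adjoint, so each fact about T also gives one about
T*. -/
theorem neg : IsSkewPair Q (-V) where
  isPositive := h.isPositive
  ker_eq_bot := h.ker_eq_bot
  star_mul_self := by rw [star_neg, neg_mul_neg, h.star_mul_self]
  mul_eq := by rw [mul_neg, h.mul_eq, star_neg, neg_mul]
  exists_star_apply_eq_zero := by
    obtain ⟨x, hx, hx'⟩ := h.exists_star_apply_eq_zero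
    exact ⟨x, hx, by rw [star_neg, neg_apply, hx', neg_zero]⟩

theorem star_Q : star Q = Q := h.isPositive.isSelfAdjoint.star_eq

theorem star_apply_apply (x : H) : star V (V x) = x :=
  congrArg (fun A : H →L[ℂ] H => A x) h.star_mul_self

theorem norm_apply (x : H) : ‖V x‖ = ‖x‖ := by
  have h1 : ⟪V x, V x⟫_ℂ = ⟪x, x⟫_ℂ := by rw [inner_apply_eq_star, h.star_apply_apply]
  rw [inner_self_eq_norm_sq_to_K, inner_self_eq_norm_sq_to_K] at h1
  have h2 : ‖V x‖ ^ 2 = ‖x‖ ^ 2 := by exact_mod_cast h1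
  exact (sq_eq_sq₀ (norm_nonneg _) (norm_nonneg _)).1 h2

theorem norm_star_apply_le (x : H) : ‖star V x‖ ≤ ‖x‖ := by
  have h1 : ‖V‖ ≤ 1 := V.opNorm_le_bound zero_le_one fun x => by rw [h.norm_apply, one_mul]
  calc ‖star V x‖ ≤ ‖star V‖ * ‖x‖ := (star V).le_opNorm x
    _ ≤ 1 * ‖x‖ := by
      rw [norm_star]
      gcongr
    _ = ‖x‖ := one_mul _

theorem not_surjective : ¬ Function.Surjective V := by
  intro hs
  obtain ⟨x, hx, hx'⟩ := h.exists_star_apply_eq_zero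
  obtain ⟨y, rfl⟩ := hs x
  rw [h.star_apply_apply] at hx'
  exact hx (by rw [hx', map_zero])

theorem root_eq : Q * (1 + V) = (1 - star V) * Q := by
  rw [mul_add, h.mul_eq, sub_mul, mul_one, one_mul, sub_eq_add_neg]

theorem star_root : star (Q * (1 + V)) = Q * (1 - V) := by
  have := h.neg.root_eq
  rw [star_mul, star_add, star_one, h.star_Q]
  rw [star_neg, sub_neg_eq_add] at this
  rw [← this, sub_eq_add_neg]

theorem inner_root_re (u : H) : (⟪u, (Q * (1 + V)) u⟫_ℂ).re = (⟪u, Q u⟫_ℂ).re := by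
  have h1 : (⟪u, (Q * (1 + V)) u⟫_ℂ).re = (⟪u, (Q * (1 - V)) u⟫_ℂ).re := by
    rw [inner_apply_eq_star, h.star_root, ← inner_conj_symm, Complex.conj_re]
  have h2 : (Q * (1 + V)) u + (Q * (1 - V)) u = Q u + Q u := by
    simp only [mul_apply_eq_comp, add_apply, sub_apply, one_apply_eq_self, map_add,
      map_sub]
    abel
  have h3 := congrArg (fun y => (⟪u, y⟫_ℂ).re) h2
  simp only [inner_add_right, Complex.add_re] at h3
  linarith

/-- T = (1 - V*) Q with ‖1 - V*‖ ≤ 2, and Re T = Q. The summand 1 only makes the constant visibly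
positive. -/
theorem root_sectorial_bound (u : H) :
    ‖(Q * (1 + V)) u‖ ^ 2 ≤ 4 * (‖Q‖ + 1) * (⟪u, (Q * (1 + V)) u⟫_ℂ).re := by
  rw [h.inner_root_re, h.root_eq]
  have h0 : 0 ≤ (⟪u, Q u⟫_ℂ).re := h.isPositive.re_inner_nonneg_right u
  have h1 : ‖((1 - star V) * Q) u‖ ≤ 2 * ‖Q u‖ := by
    calc ‖Q u - star V (Q u)‖ ≤ ‖Q u‖ + ‖star V (Q u)‖ := norm_sub_le _ _
      _ ≤ ‖Q u‖ + ‖Q u‖ := by gcongr; exact h.norm_star_apply_le _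
      _ = _ := by ring
  calc ‖((1 - star V) * Q) u‖ ^ 2 ≤ (2 * ‖Q u‖) ^ 2 := by gcongr
    _ = 4 * ‖Q u‖ ^ 2 := by ring
    _ ≤ 4 * (‖Q‖ * (⟪u, Q u⟫_ℂ).re) := by
      gcongr
      exact norm_sq_apply_le_of_isPositive h.isPositive u
    _ ≤ _ := by nlinarith

theorem root_add_star : (1 / 2 : ℂ) • (Q * (1 + V) + star (Q * (1 + V))) = Q := by
  rw [h.star_root, ← mul_add, show (1 + V) + (1 - V) = (2 : ℂ) • 1 by rw [two_smul]; abel,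
    mul_smul_comm, smul_smul, mul_one]
  norm_num

theorem ker_root : (Q * (1 + V)).ker = ⊥ := ker_eq_bot_of_forall fun u hu => by
  have h1 := h.inner_root_re u
  rw [hu, inner_zero_right, Complex.zero_re] at h1
  have h2 := norm_sq_apply_le_of_isPositive h.isPositive u
  rw [← h1, mul_zero] at h2
  exact eq_zero_of_ker h.ker_eq_bot
    (norm_eq_zero.1 (pow_eq_zero_iff two_ne_zero |>.1 (le_antisymm h2 (sq_nonneg _))))

theorem ker_one_add : (1 + V).ker = ⊥ := ker_eq_bot_of_forall fun u hu => by
  refine eq_zero_of_ker h.ker_root ?_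
  rw [mul_apply_eq_comp, hu, map_zero]

/-- If V* u = u then (V u, u) = ‖u‖² = ‖V u‖², which forces V u = u. -/
theorem ker_one_sub_star : (1 - star V).ker = ⊥ := ker_eq_bot_of_forall fun u hu => by
  have h1 : star V u = u := (sub_eq_zero.1 hu).symm
  have h2 : ⟪u, V u⟫_ℂ = ⟪u, u⟫_ℂ := by rw [inner_apply_eq_star, h1]
  have h3 : ‖u - V u‖ ^ 2 = 0 := by
    rw [@norm_sub_sq ℂ, h2, h.norm_apply, inner_self_eq_norm_sq_to_K]
    simp [← Complex.ofReal_pow]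
    ring
  refine eq_zero_of_ker h.neg.ker_one_add ?_
  have h4 := norm_eq_zero.1 (pow_eq_zero_iff two_ne_zero |>.1 h3)
  simpa [sub_eq_add_neg] using h4

theorem ker_one_add_star : (1 + star V).ker = ⊥ := by
  have := h.neg.ker_one_sub_star
  rwa [star_neg, sub_neg_eq_add] at this

theorem ker_star_root : (star (Q * (1 + V))).ker = ⊥ := by
  rw [h.star_root]
  have := h.neg.ker_root
  rwa [← sub_eq_add_neg] at this

theorem denseRange_root : DenseRange (Q * (1 + V) : H →L[ℂ] H) :=
  denseRange_of_ker_star h.ker_star_root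

theorem denseRange_Q : DenseRange Q :=
  denseRange_of_ker_star (by rw [h.star_Q]; exact h.ker_eq_bot)

theorem denseRange_one_add : DenseRange (1 + V : H →L[ℂ] H) :=
  denseRange_of_ker_star (by rw [star_add, star_one]; exact h.ker_one_add_star)

/-- The imaginary part is the form of the selfadjoint R = -iQV. As V* is a contraction, R² = Q V V*
Q ≤ Q², hence R ≤ Q. The opposite bound comes from -V. -/
theorem im_inner_root_le (u : H) : (⟪u, (Q * (1 + V)) u⟫_ℂ).im ≤ (⟪u, Q u⟫_ℂ).re := by
  set R : H →L[ℂ] H := (-Complex.I) • (Q * V) with hR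
  have hstar : star (Q * V) = -(Q * V) := by
    rw [star_mul, h.star_Q, h.mul_eq, neg_neg]
  have hRsa : IsSelfAdjoint R := by
    rw [IsSelfAdjoint, hR, star_smul, hstar]
    simp
  have h0 : 0 ≤ Q := (ContinuousLinearMap.nonneg_iff_isPositive Q).2 h.isPositive
  have hRR : R * R = Q * V * star V * Q := by
    rw [hR, smul_mul_smul_comm, show -Complex.I * -Complex.I = -1 by simp, neg_one_smul,
      ← mul_neg, ← hstar, star_mul, h.star_Q]
    simp only [mul_assoc]
  have hle : R * R ≤ Q * Q := by
    rw [hRR, ContinuousLinearMap.le_def, ContinuousLinearMap.isPositive_def']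
    refine ⟨?_, fun x => ?_⟩
    · rw [IsSelfAdjoint, star_sub, star_mul, star_mul, star_mul, star_mul, star_star, h.star_Q]
      simp only [mul_assoc]
    · have h1 : ⟪(Q * Q - Q * V * star V * Q) x, x⟫_ℂ =
          ⟪Q x, Q x⟫_ℂ - ⟪star V (Q x), star V (Q x)⟫_ℂ := by
        rw [sub_apply, inner_sub_left, inner_star_apply_eq, inner_apply_eq_star Q,
          inner_apply_eq_star Q, h.star_Q]
        rfl
      rw [ContinuousLinearMap.reApplyInnerSelf, h1, inner_self_eq_norm_sq_to_K,
        inner_self_eq_norm_sq_to_K]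
      have := h.norm_star_apply_le (Q x)
      simp only [map_sub, ← map_pow, RCLike.ofReal_re]
      rw [sub_nonneg]
      gcongr
  have hRQ := le_of_sq_le_sq_of_isSelfAdjoint h0 hRsa hle
  rw [ContinuousLinearMap.le_def] at hRQ
  have h1 := hRQ.re_inner_nonneg_right u
  rw [sub_apply, inner_sub_right, map_sub] at h1
  have h2 : (⟪u, R u⟫_ℂ).re = (⟪u, (Q * V) u⟫_ℂ).im := by
    rw [hR, smul_apply, inner_smul_right]
    simp
  have h3 : (⟪u, Q u⟫_ℂ).im = 0 := by
    have : ⟪u, Q u⟫_ℂ = ⟪Q u, u⟫_ℂ := by rw [inner_apply_eq_star, h.star_Q]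
    rw [← inner_conj_symm] at this
    exact Complex.conj_eq_iff_im.1 (by rw [inner_conj_symm, ← this, inner_conj_symm])
  rw [mul_add, mul_one, add_apply, inner_add_right, Complex.add_im, h3, zero_add, ← h2]
  simp only [RCLike.re_to_complex] at h1
  linarith

theorem isSectorialWith_root : IsSectorialWith (Real.pi / 4) (ofBounded (Q * (1 + V))) := by
  intro z hz
  obtain ⟨x, y, hxy, -, rfl⟩ := mem_numericalRange.1 hz
  rw [mem_graph_ofBounded] at hxy
  subst hxy
  refine abs_arg_le_pi_div_four ?_
  rw [h.inner_root_re, abs_le]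
  refine ⟨?_, h.im_inner_root_le x⟩
  have h1 := h.neg.im_inner_root_le x
  rw [← sub_eq_add_neg, ← h.star_root, inner_star_apply_eq, ← inner_conj_symm, Complex.conj_im]
    at h1
  linarith

/-- Equal ranges would make 1 + V onto. Solving (1 + V) x = (1 + V*) y and noting (1 + V*) V x = V x
+ x, injectivity of 1 + V* would give V x = y, so V would be onto. -/
theorem range_root_ne : (Q * (1 + V)).range ≠ (star (Q * (1 + V))).range := by
  rw [h.star_root]
  intro heq
  have hQinj : Function.Injective Q := LinearMap.ker_eq_bot.1 h.ker_eq_bot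
  have hsurj : Function.Surjective (1 + V : H →L[ℂ] H) := by
    intro x
    have h1 : (Q * (1 - V)) ((1 / 2 : ℂ) • x) ∈ (Q * (1 + V)).range := by
      rw [heq]
      exact ⟨_, rfl⟩
    obtain ⟨y, hy⟩ := h1
    have hy' : (1 + V) y = (1 - V) ((1 / 2 : ℂ) • x) := hQinj hy
    refine ⟨y + (1 / 2 : ℂ) • x, ?_⟩
    rw [map_add, hy']
    simp only [add_apply, sub_apply, one_apply_eq_self]
    module
  refine h.not_surjective fun y => ?_
  obtain ⟨x, hx⟩ := hsurj ((1 + star V) y)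
  refine ⟨x, LinearMap.ker_eq_bot.1 h.ker_one_add_star ?_⟩
  change (1 + star V) (V x) = (1 + star V) y
  rw [← hx]
  simp only [add_apply, one_apply_eq_self, h.star_apply_apply]
  exact add_comm _ _

theorem root_mul_root :
    Q * (1 + V) * (Q * (1 + V)) = Q * (1 + V) * (1 - star V) * Q := by
  conv_lhs => rw [h.root_eq, ← h.root_eq]
  rw [mul_assoc (Q * (1 + V)), ← h.root_eq]

theorem inner_sq (u : H) : ⟪u, (Q * (1 + V) * (Q * (1 + V))) u⟫_ℂ =
    ⟪(1 + star V) (Q u), (1 - star V) (Q u)⟫_ℂ := by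
  rw [mul_apply_eq_comp, inner_apply_eq_star, h.star_root, h.root_eq]
  have := h.neg.root_eq
  rw [star_neg, sub_neg_eq_add, ← sub_eq_add_neg] at this
  rw [this]
  rfl

omit h in
theorem inner_add_sub_re (y : H) :
    (⟪(1 + star V) y, (1 - star V) y⟫_ℂ).re = ‖y‖ ^ 2 - ‖star V y‖ ^ 2 := by
  simp only [add_apply, sub_apply, one_apply_eq_self, inner_add_left, inner_sub_right,
    Complex.add_re, Complex.sub_re, inner_self_eq_norm_sq_to_K]
  rw [← inner_conj_symm y, Complex.conj_re]
  simp [← Complex.ofReal_pow]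
  ring

theorem sq_accretive (u : H) : 0 ≤ (⟪u, (Q * (1 + V) * (Q * (1 + V))) u⟫_ℂ).re := by
  rw [h.inner_sq, inner_add_sub_re, sub_nonneg]
  have := h.norm_star_apply_le (Q u)
  gcongr

/-- The form of the square of the root is not dominated by its real part. -/
theorem not_dominated_sq {c : ℝ} (hc : 0 < c) :
    ¬ ∀ u, c * ‖⟪u, (Q * (1 + V) * (Q * (1 + V))) u⟫_ℂ‖ ≤
      (⟪u, (Q * (1 + V) * (Q * (1 + V))) u⟫_ℂ).re := by
  intro hdom
  have hy : ∀ y, c * ‖⟪(1 + star V) y, (1 - star V) y⟫_ℂ‖ ≤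
      (⟪(1 + star V) y, (1 - star V) y⟫_ℂ).re := by
    intro y
    refine h.denseRange_Q.induction_on
      (p := fun y => c * ‖⟪(1 + star V) y, (1 - star V) y⟫_ℂ‖ ≤
        (⟪(1 + star V) y, (1 - star V) y⟫_ℂ).re) y (isClosed_le ?_ ?_) fun u => ?_
    · fun_prop
    · exact Complex.continuous_re.comp (by fun_prop)
    · rw [← h.inner_sq]
      exact hdom u
  have hsymm : ∀ x, ⟪V x, x⟫_ℂ = ⟪x, V x⟫_ℂ := by
    intro x
    -- On ran V the real part is zero, so domination kills the whole form; what remains says that (V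
    -- x, x) is real.
    have h1 := hy (V x)
    rw [inner_add_sub_re, h.star_apply_apply, h.norm_apply, sub_self] at h1
    have h2 := norm_le_zero_iff.1 (nonpos_of_mul_nonpos_right h1 hc)
    simp only [add_apply, sub_apply, one_apply_eq_self, h.star_apply_apply, inner_add_left,
      inner_sub_right] at h2
    have h3 : ⟪V x, V x⟫_ℂ = ⟪x, x⟫_ℂ := by rw [inner_apply_eq_star, h.star_apply_apply]
    rw [h3] at h2
    linear_combination -h2
  have hVsa : star V = V := by
    have : IsSelfAdjoint V := by
      rw [ContinuousLinearMap.isSelfAdjoint_iff_isSymmetric,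
        LinearMap.isSymmetric_iff_inner_map_self_real]
      intro x
      rw [inner_conj_symm]
      exact (hsymm x).symm
    exact this.star_eq
  exact h.not_surjective fun x => ⟨star V x, by
    have := h.star_apply_apply x
    rw [hVsa] at this ⊢
    exact this⟩

theorem ker_sq : (Q * (1 + V) * (Q * (1 + V))).ker = ⊥ := ker_eq_bot_of_forall fun _ hx =>
  eq_zero_of_ker h.ker_root (eq_zero_of_ker h.ker_root hx)

theorem ker_star_sq : (star (Q * (1 + V) * (Q * (1 + V)))).ker = ⊥ :=
  ker_eq_bot_of_forall fun _ hx => by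
    rw [star_mul] at hx
    exact eq_zero_of_ker h.ker_star_root (eq_zero_of_ker h.ker_star_root hx)

theorem isAccretive_sq : IsAccretive (ofBounded (Q * (1 + V) * (Q * (1 + V)))) :=
  isAccretive_iff.2 fun x y hxy => by
    rw [mem_graph_ofBounded] at hxy
    rw [← hxy]
    exact h.sq_accretive x

theorem not_isSectorial_sq : ¬ IsSectorial (ofBounded (Q * (1 + V) * (Q * (1 + V)))) := by
  intro hs
  obtain ⟨c, hc, hdom⟩ := hs.exists_norm_le
  exact h.not_dominated_sq hc fun u => hdom _ _ (mem_graph_ofBounded.2 rfl)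

theorem not_isSectorial_inverse_sq :
    ¬ IsSectorial (ofBounded (Q * (1 + V) * (Q * (1 + V)))).inverse := by
  intro hs
  obtain ⟨c, hc, hdom⟩ := hs.exists_norm_le
  refine h.not_dominated_sq hc fun u => ?_
  have := hdom _ u ((mem_graph_inverse_ofBounded h.ker_sq).2 rfl)
  rwa [norm_inner_symm, ← inner_conj_symm _ u, Complex.conj_re] at this

theorem isMAccretive_inverse_sq :
    IsMAccretive (ofBounded (Q * (1 + V) * (Q * (1 + V)))).inverse :=
  isMAccretive_inverse_ofBounded h.ker_sq (denseRange_of_ker_star h.ker_star_sq) h.sq_accretive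

theorem mem_graph_quotient {x y : H} :
    (x, y) ∈ (prod (ofBounded (Q * (1 + V))).inverse (ofBounded (star (Q * (1 + V))))).graph ↔
      (1 + V) y = (1 - V) x := by
  simp only [mem_graph_prod, mem_graph_inverse_ofBounded h.ker_root, mem_graph_ofBounded,
    exists_eq_left']
  rw [h.star_root]
  exact (LinearMap.ker_eq_bot.1 h.ker_eq_bot).eq_iff (a := (1 + V) y) (b := (1 - V) x)

theorem quotient_spec {F : H →ₗ.[ℂ] H}
    (hF : F = prod (ofBounded (Q * (1 + V))).inverse (ofBounded (star (Q * (1 + V))))) :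
    IsMAccretive F ∧ HasZeroRealPart F ∧ F.domain < F†.domain := by
  have hgr : ∀ {x y}, (x, y) ∈ F.graph ↔ ∃ u, x = (1 + V) u ∧ y = (1 - V) u := by
    intro x y
    rw [hF, h.mem_graph_quotient]
    refine ⟨exists_eq_one_add_eq_one_sub, ?_⟩
    rintro ⟨u, rfl, rfl⟩
    simp only [add_apply, sub_apply, one_apply_eq_self, map_add, map_sub]
    abel
  have hzero : HasZeroRealPart F := by
    rw [hasZeroRealPart_iff]
    intro x y hxy
    obtain ⟨u, rfl, rfl⟩ := hgr.1 hxy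
    simp only [add_apply, sub_apply, one_apply_eq_self, inner_add_left, inner_sub_right,
      Complex.add_re, Complex.sub_re, inner_self_eq_norm_sq_to_K]
    rw [← inner_conj_symm u, Complex.conj_re, h.norm_apply]
    ring
  have hdom : Dense (F.domain : Set H) := by
    refine h.denseRange_one_add.mono ?_
    rintro _ ⟨u, rfl⟩
    exact LinearPMap.mem_domain_of_mem_graph (hgr.2 ⟨u, rfl, rfl⟩)
  refine ⟨⟨hzero.isAccretive, hdom, -1, by simp, fun g => ?_⟩, hzero, ?_⟩
  · have hm := hgr.2 ⟨(1 / 2 : ℂ) • g, rfl, rfl⟩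
    rw [LinearPMap.mem_graph_iff] at hm
    obtain ⟨w, hw1, hw2⟩ := hm
    refine ⟨w, ?_⟩
    rw [hw1, hw2]
    simp only [add_apply, sub_apply, one_apply_eq_self]
    module
  · rw [lt_iff_le_not_ge]
    constructor
    · intro x hx
      obtain ⟨y, hxy⟩ := LinearPMap.mem_domain_iff.1 hx
      obtain ⟨u, rfl, rfl⟩ := hgr.1 hxy
      -- Zero real part means that F† extends -F.
      refine LinearPMap.mem_domain_of_mem_graph (y := -((1 - V) u))
        ((mem_graph_adjoint hdom).2 ?_)
      intro a b hab
      obtain ⟨v, rfl, rfl⟩ := hgr.1 hab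
      have h3 : ⟪V u, V v⟫_ℂ = ⟪u, v⟫_ℂ := by rw [inner_apply_eq_star, h.star_apply_apply]
      simp only [add_apply, sub_apply, one_apply_eq_self, inner_add_left, inner_sub_right,
        inner_add_right, inner_sub_left, inner_neg_left, h3]
      ring
    · intro hle
      -- Any x in ker V* satisfies F† x = x. If x = (1 + V) u were in dom F, applying V* would give
      -- (1 + V*) u = 0, so x = 0.
      obtain ⟨x, hx, hVx⟩ := h.exists_star_apply_eq_zero
      have hx1 : x ∈ F.domain := hle (LinearPMap.mem_domain_of_mem_graph (y := x)
        ((mem_graph_adjoint hdom).2 (by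
          intro a b hab
          obtain ⟨v, rfl, rfl⟩ := hgr.1 hab
          simp only [add_apply, sub_apply, one_apply_eq_self, inner_sub_right,
            inner_add_right, inner_apply_eq_star V, hVx, inner_zero_left]
          ring)))
      obtain ⟨y, hxy⟩ := LinearPMap.mem_domain_iff.1 hx1
      obtain ⟨u, rfl, -⟩ := hgr.1 hxy
      refine hx ?_
      have hu : u = 0 := eq_zero_of_ker h.ker_one_add_star (by
        simp only [add_apply, one_apply_eq_self, map_add, h.star_apply_apply] at hVx ⊢
        rw [add_comm]
        exact hVx)
      rw [hu, map_zero]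

theorem range_sq_inf {M : Submodule ℂ H} (hVM : ∀ x, V x ∈ M) (hM : M ⊓ Q.range = ⊥) :
    (Q * (1 + V) * (Q * (1 + V))).range ⊓ (star (Q * (1 + V)) * star (Q * (1 + V))).range = ⊥ := by
  rw [eq_bot_iff]
  rintro _ ⟨⟨f, rfl⟩, ⟨g, hg⟩⟩
  have hT := h.root_mul_root
  have hT' := h.neg.root_mul_root
  rw [star_neg, sub_neg_eq_add, ← sub_eq_add_neg] at hT'
  rw [h.star_root, hT'] at hg
  have hQinj : Function.Injective Q := LinearMap.ker_eq_bot.1 h.ker_eq_bot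
  have h1 : (1 - V) ((1 + star V) (Q g)) = (1 + V) ((1 - star V) (Q f)) := by
    refine hQinj (hg.trans ?_)
    rw [hT]
    rfl
  simp only [add_apply, sub_apply, one_apply_eq_self, map_add, map_sub] at h1
  -- Applying V* collapses the identity to (1 + V*)(1 - V*)(Q f + Q g) = 0. Putting Q g = -Q f back
  -- leaves Q f = V V* Q f, so Q f lies in ran V, inside M.
  have h2 := congrArg (fun z => star V z) h1
  simp only [map_add, map_sub, h.star_apply_apply] at h2
  have h3 : Q f + Q g = 0 := by
    refine eq_zero_of_ker h.ker_one_sub_star (eq_zero_of_ker h.ker_one_add_star ?_)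
    simp only [add_apply, sub_apply, one_apply_eq_self, map_add, map_sub]
    rw [← sub_eq_zero] at h2
    rw [← neg_eq_zero, ← h2]
    abel
  have h4 : Q g = -Q f := eq_neg_of_add_eq_zero_right h3
  simp only [h4, map_neg] at h1
  have h5 : Q f = V (star V (Q f)) := by
    have h6 : (2 : ℂ) • (Q f - V (star V (Q f))) = 0 := by
      rw [← sub_eq_zero] at h1
      rw [two_smul, ← neg_eq_zero, ← h1]
      abel
    exact sub_eq_zero.1 ((smul_eq_zero.1 h6).resolve_left two_ne_zero)
  have h7 : Q f ∈ M ⊓ Q.range := ⟨h5 ▸ hVM _, ⟨f, rfl⟩⟩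
  rw [hM, Submodule.mem_bot] at h7
  have h8 : f = 0 := eq_zero_of_ker h.ker_eq_bot h7
  rw [h8, Submodule.mem_bot]
  exact map_zero _

theorem isMAccretiveSqrt_iff {S : H →ₗ.[ℂ] H} :
    IsMAccretiveSqrt (ofBounded (Q * (1 + V) * (Q * (1 + V)))).inverse S ↔
      S = (ofBounded (Q * (1 + V))).inverse :=
  isMAccretiveSqrt_inverse_iff (by positivity) h.root_sectorial_bound h.denseRange_root h.ker_root
    rfl

theorem adjoint_inverse_sq : (ofBounded (Q * (1 + V) * (Q * (1 + V)))).inverse† =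
    (ofBounded (star (Q * (1 + V)) * star (Q * (1 + V)))).inverse := by
  rw [adjoint_inverse_ofBounded h.ker_sq h.ker_star_sq, star_mul]

theorem isMAccretiveSqrt_adjoint_iff {R : H →ₗ.[ℂ] H} :
    IsMAccretiveSqrt ((ofBounded (Q * (1 + V) * (Q * (1 + V)))).inverse†) R ↔
      R = (ofBounded (star (Q * (1 + V)))).inverse := by
  rw [h.adjoint_inverse_sq, h.star_root, sub_eq_add_neg]
  exact h.neg.isMAccretiveSqrt_iff

end IsSkewPair

end SkewPairs

/-! ### The isometry K and the family of powers -/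

section Construction

variable {H : Type*} [NormedAddCommGroup H] [InnerProductSpace ℂ H] [CompleteSpace H]

/-- The factor `K` in `(Q P_M Q)^{1/2} = Q K` is an isometry with `K K* = P_M`. -/
theorem exists_isometric_factor {Q : H →L[ℂ] H} (hQ : Q.IsPositive) (hQker : Q.ker = ⊥)
    (M : Submodule ℂ H) [M.HasOrthogonalProjection] (hMQ : Mᗮ ⊓ Q.range = ⊥) :
    ∃ K : H →L[ℂ] H, Q * K = CFC.sqrt (Q * M.starProjection * Q) ∧ Q * K = star K * Q ∧
      star K * K = 1 ∧ K * star K = M.starProjection := by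
  set P := M.starProjection with hP
  have hPP : P * P = P := Submodule.isIdempotentElem_starProjection M
  have hPsa : star P = P := (isSelfAdjoint_starProjection M).star_eq
  have hQsa : star Q = Q := hQ.isSelfAdjoint.star_eq
  have hQd : DenseRange Q := denseRange_of_ker_star (by rw [hQsa]; exact hQker)
  have hA : Q * P * Q = star (P * Q) * (P * Q) := by
    rw [star_mul, hPsa, hQsa, mul_assoc Q P (P * Q), ← mul_assoc P P Q, hPP, mul_assoc]
  have hA0 : 0 ≤ Q * P * Q := by
    rw [hA]
    exact star_mul_self_nonneg _
  set S := CFC.sqrt (Q * P * Q) with hS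
  have hSS : S * S = Q * P * Q := CFC.sqrt_mul_sqrt_self _
  have hSsa : star S = S := (CFC.sqrt_nonneg (Q * P * Q)).isSelfAdjoint.star_eq
  have hnorm : ∀ x, ‖S x‖ = ‖P (Q x)‖ := by
    intro x
    have h1 : ⟪S x, S x⟫_ℂ = ⟪(P * Q) x, (P * Q) x⟫_ℂ := by
      rw [inner_apply_eq_star, inner_apply_eq_star, hSsa, ← mul_apply_eq_comp S S,
        ← mul_apply_eq_comp (star (P * Q)), hSS, hA]
    rw [inner_self_eq_norm_sq_to_K, inner_self_eq_norm_sq_to_K] at h1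
    have h2 : ‖S x‖ ^ 2 = ‖P (Q x)‖ ^ 2 := by exact_mod_cast h1
    exact (sq_eq_sq₀ (norm_nonneg _) (norm_nonneg _)).1 h2
  have hle : ∀ x, ‖(S : H →ₗ[ℂ] H) x‖ ≤ 1 * ‖(Q : H →ₗ[ℂ] H) x‖ := fun x => by
    rw [one_mul]
    exact (hnorm x).trans_le (M.norm_starProjection_apply_le _)
  -- L is the extension by continuity of Q x ↦ S x from the dense range of Q; its adjoint is the
  -- desired K.
  set L : H →L[ℂ] H := (S : H →ₗ[ℂ] H).extendOfNorm (Q : H →ₗ[ℂ] H) with hL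
  have hLQ : L * Q = S := by
    ext x
    exact LinearMap.extendOfNorm_eq hQd ⟨1, hle⟩ x
  have hQK : Q * star L = S := by
    rw [← hSsa, ← hLQ, star_mul, hQsa]
  have hQinj : ∀ {A B : H →L[ℂ] H}, Q * A = Q * B → A = B := fun {A B} hAB => by
    ext x
    exact LinearMap.ker_eq_bot.1 hQker (congrArg (fun T : H →L[ℂ] H => T x) hAB)
  have hQinj' : ∀ {A B : H →L[ℂ] H}, A * Q = B * Q → A = B := fun {A B} hAB => by
    rw [← star_inj, star_mul, star_mul, hQsa] at hAB
    exact star_inj.1 (hQinj hAB)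
  have hKK : star L * L = P := by
    refine hQinj' (hQinj ?_)
    rw [mul_assoc, hLQ, ← mul_assoc, hQK, hSS, mul_assoc]
  have hSker : ∀ x, S x = 0 → x = 0 := by
    intro x hx
    have h1 : P (Q x) = 0 := by
      rw [← norm_eq_zero, ← hnorm, hx, norm_zero]
    have h2 : Q x ∈ Mᗮ ⊓ Q.range :=
      ⟨(Submodule.starProjection_apply_eq_zero_iff M).1 h1, ⟨x, rfl⟩⟩
    rw [hMQ, Submodule.mem_bot] at h2
    exact eq_zero_of_ker hQker h2
  have hSinj : ∀ {A B : H →L[ℂ] H}, S * A = S * B → A = B := fun {A B} hAB => by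
    ext x
    rw [← sub_eq_zero]
    refine hSker _ ?_
    rw [map_sub, sub_eq_zero]
    exact congrArg (fun T : H →L[ℂ] H => T x) hAB
  -- S L L* = Q P L* = Q L* = S, and S is injective.
  have hiso : L * star L = 1 := by
    have hSL : S * L = Q * P := by rw [← hQK, mul_assoc, hKK]
    have hPK : P * star L = star L := by
      rw [← sub_eq_zero, ← CStarRing.mul_star_self_eq_zero_iff, star_sub, star_mul, star_star,
        hPsa, sub_mul, mul_sub, mul_sub, mul_assoc, ← mul_assoc (star L), hKK, mul_assoc P,
        hKK, hPP, hPP]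
      abel
    refine hSinj ?_
    rw [← mul_assoc, hSL, mul_assoc, hPK, hQK, mul_one]
  exact ⟨star L, hQK, by rw [star_star, hQK, hLQ], by rwa [star_star], by rwa [star_star]⟩

theorem ofBounded_eq_quotientOp {Q K : H →L[ℂ] H} (hQker : Q.ker = ⊥) {M : Submodule ℂ H}
    [M.HasOrthogonalProjection] (hQK : Q * K = CFC.sqrt (Q * M.starProjection * Q)) :
    ofBounded K = quotientOp Q M := by
  rw [linearPMap_eq_iff]
  intro x y
  rw [quotientOp, ← hQK]
  simp only [mem_graph_prod, mem_graph_inverse_ofBounded hQker, mem_graph_ofBounded,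
    exists_eq_left']
  exact eq_comm.trans ((LinearMap.ker_eq_bot.1 hQker).eq_iff (a := y) (b := K x)).symm

theorem star_pow_mul_pow {K : H →L[ℂ] H} (hK : star K * K = 1) (m : ℕ) :
    star (K ^ m) * K ^ m = 1 := by
  induction m with
  | zero => simp
  | succ m ih =>
    rw [pow_succ, star_mul, mul_assoc, ← mul_assoc (star (K ^ m)), ih, one_mul, hK]

theorem mul_pow_eq_star_pow_mul {Q K : H →L[ℂ] H} (h : Q * K = star K * Q) (m : ℕ) :
    Q * K ^ m = star (K ^ m) * Q := by
  rw [star_pow]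
  exact (SemiconjBy.pow_right (a := Q) (x := K) (y := star K) h m)

omit [CompleteSpace H] in
theorem I_smul_pow (K : H →L[ℂ] H) (n : ℕ) :
    (Complex.I • K) ^ (2 * n + 1) = ((-1) ^ n * Complex.I) • K ^ (2 * n + 1) := by
  rw [smul_pow, pow_succ, pow_mul, Complex.I_sq]

/-- The exponent is odd so that the scalar c = ±i satisfies conj c = -c, which supplies the sign in
the skew relation. Nonunitarity: K* vanishes on M^⊥. -/
theorem isSkewPair_pow {Q K : H →L[ℂ] H} (hQ : Q.IsPositive) (hQker : Q.ker = ⊥)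
    {M : Submodule ℂ H} [M.HasOrthogonalProjection] (hM : M ≠ ⊤) (hQK : Q * K = star K * Q)
    (hK : star K * K = 1) (hKK : K * star K = M.starProjection) (n : ℕ) :
    IsSkewPair Q ((Complex.I • K) ^ (2 * n + 1)) := by
  set c : ℂ := (-1) ^ n * Complex.I with hc
  have hcc : star c = -c := by simp [hc]
  have hc2 : c * c = -1 := by
    rw [hc, mul_mul_mul_comm, Complex.I_mul_I, ← mul_pow]
    simp
  rw [I_smul_pow]
  refine ⟨hQ, hQker, ?_, ?_, ?_⟩
  · rw [star_smul, smul_mul_smul_comm, star_pow_mul_pow hK, hcc, neg_mul, hc2, neg_neg, one_smul]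
  · rw [star_smul, hcc, neg_smul, neg_mul, neg_neg, mul_smul_comm, smul_mul_assoc,
      mul_pow_eq_star_pow_mul hQK]
  · have hMo : Mᗮ ≠ ⊥ := fun h => hM ((Submodule.orthogonal_eq_bot_iff).1 h)
    obtain ⟨x, hx, hx0⟩ := Submodule.exists_mem_ne_zero_of_ne_bot hMo
    refine ⟨x, hx0, ?_⟩
    have h1 : K (star K x) = 0 := by
      rw [← mul_apply_eq_comp, hKK]
      exact (Submodule.starProjection_apply_eq_zero_iff M).2 hx
    have h2 : star K x = 0 := by
      have : (star K * K) (star K x) = 0 := by rw [mul_apply_eq_comp, h1, map_zero]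
      rwa [hK] at this
    rw [star_smul, star_pow, pow_succ, smul_apply, mul_apply_eq_comp, h2, map_zero, smul_zero]

theorem pow_apply_mem {K : H →L[ℂ] H} {M : Submodule ℂ H} [M.HasOrthogonalProjection]
    (hK : star K * K = 1) (hKK : K * star K = M.starProjection) (n : ℕ) (x : H) :
    ((Complex.I • K) ^ (2 * n + 1)) x ∈ M := by
  have h1 : ∀ y, K y ∈ M := fun y => by
    have : K y = M.starProjection (K y) := by
      rw [← hKK, mul_apply_eq_comp, ← mul_apply_eq_comp (star K), hK, one_apply_eq_self]
    rw [this]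
    exact M.starProjection_apply_mem _
  rw [pow_succ', mul_apply_eq_comp, smul_apply]
  exact M.smul_mem _ (h1 _)

theorem squareOp_eq {Q Z : H →L[ℂ] H} {n : ℕ} (h : IsSkewPair Q (Z ^ (2 * n + 1))) :
    squareOp Q Z n = Q * (1 + Z ^ (2 * n + 1)) * (Q * (1 + Z ^ (2 * n + 1))) := by
  rw [h.root_mul_root, squareOp, star_pow]

/-- Cancelling the isometry Z^(2m+1) on the left would give Z a right inverse, making it onto. -/
theorem IsSkewPair.pow_injective {Q Z : H →L[ℂ] H} (h : ∀ n, IsSkewPair Q (Z ^ (2 * n + 1)))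
    {m n : ℕ} (hmn : m < n) : Z ^ (2 * m + 1) ≠ Z ^ (2 * n + 1) := by
  intro heq
  obtain ⟨k, rfl⟩ := Nat.exists_eq_add_of_lt hmn
  have h1 : Z ^ (2 * (m + k + 1) + 1) = Z ^ (2 * m + 1) * (Z * Z ^ (2 * k + 1)) := by
    rw [← pow_succ', ← pow_add]
    congr 1
    ring
  have h2 : Z * Z ^ (2 * k + 1) = 1 := by
    have := congrArg (star (Z ^ (2 * m + 1)) * ·) (h1 ▸ heq)
    rw [← mul_assoc, (h m).star_mul_self, one_mul] at this
    exact this.symm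
  have hns := (h 0).not_surjective
  rw [mul_zero, zero_add, pow_one] at hns
  exact hns fun x => ⟨(Z ^ (2 * k + 1)) x, congrArg (fun A : H →L[ℂ] H => A x) h2⟩

/-- Equal operators have the same m-accretive square root, so the roots Q(1 + Z^(2n+1)) agree;
injectivity of Q then equates the powers of Z. -/
theorem injective_katoOp {Q Z : H →L[ℂ] H} (h : ∀ n, IsSkewPair Q (Z ^ (2 * n + 1))) :
    Function.Injective (katoOp Q Z) := by
  intro m n hmn
  have hroot : (ofBounded (Q * (1 + Z ^ (2 * m + 1)))).inverse =
      (ofBounded (Q * (1 + Z ^ (2 * n + 1)))).inverse := by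
    refine (h n).isMAccretiveSqrt_iff.1 ?_
    rw [katoOp, katoOp, squareOp_eq (h m), squareOp_eq (h n)] at hmn
    rw [← hmn]
    exact (h m).isMAccretiveSqrt_iff.2 rfl
  have hZ : Z ^ (2 * m + 1) = Z ^ (2 * n + 1) := by
    ext x
    have h1 : ((Q * (1 + Z ^ (2 * m + 1))) x, x) ∈
        (ofBounded (Q * (1 + Z ^ (2 * m + 1)))).inverse.graph :=
      (mem_graph_inverse_ofBounded (h m).ker_root).2 rfl
    rw [hroot, mem_graph_inverse_ofBounded (h n).ker_root] at h1
    have h2 := LinearMap.ker_eq_bot.1 (h n).ker_eq_bot h1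
    exact (add_left_cancel (a := x) h2).symm
  rcases lt_trichotomy m n with hlt | heq | hlt
  · exact absurd hZ (IsSkewPair.pow_injective h hlt)
  · exact heq
  · exact absurd hZ.symm (IsSkewPair.pow_injective h hlt)

end Construction

end KatoSquareRoot

/-! ### The main theorem -/

open KatoSquareRoot in
theorem mainTheorem11 {H : Type*} [NormedAddCommGroup H] [InnerProductSpace ℂ H] [CompleteSpace H]
    (Q : H →L[ℂ] H) (hQ : Q.IsPositive) (hQker : Q.ker = ⊥) (hQran : Q.range ≠ ⊤)
    (M : Submodule ℂ H) [M.HasOrthogonalProjection] (hM : M ≠ ⊤)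
    (hMQ : Mᗮ ⊓ Q.range = ⊥) :
    ∃ K Z : H →L[ℂ] H, ofBounded K = quotientOp Q M ∧ Z = Complex.I • K ∧
      -- the operators `T n = rootOp Q Z n`
      (∀ n : ℕ, 1 ≤ n → ∀ T : H →L[ℂ] H, T = rootOp Q Z n →
        T = (1 - star Z ^ (2 * n + 1)) * Q ∧
        T = Q + ((-1) ^ n * Complex.I) • (Q * K ^ (2 * n + 1)) ∧
        IsSectorialWith (Real.pi / 4) (ofBounded T) ∧
        (1 / 2 : ℂ) • (T + star T) = Q ∧
        T.ker = ⊥ ∧ (1 + Z ^ (2 * n + 1)).ker = ⊥ ∧ (1 - star Z ^ (2 * n + 1)).ker = ⊥ ∧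
        T.range ≠ (star T).range ∧
        T ^ 2 = squareOp Q Z n ∧
        IsAccretive (ofBounded (T ^ 2)) ∧ ¬ IsSectorial (ofBounded (T ^ 2)) ∧
        (∀ F : H →ₗ.[ℂ] H, F = prod (ofBounded T).inverse (ofBounded (star T)) →
          IsMAccretive F ∧ HasZeroRealPart F ∧ F.domain < F†.domain) ∧
        (M ⊓ Q.range = ⊥ → (T ^ 2).range ⊓ (star T ^ 2).range = ⊥)) ∧
      -- the operators `B n = katoOp Q Z n`
      (∀ n : ℕ, 1 ≤ n → ∀ B : H →ₗ.[ℂ] H, B = katoOp Q Z n →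
        B = prod (ofBounded (rootOp Q Z n)).inverse (ofBounded (rootOp Q Z n)).inverse ∧
        IsMAccretive B ∧ ¬ IsSectorial B ∧
        (∃! S : H →ₗ.[ℂ] H, IsMAccretiveSqrt B S) ∧
        (∃! R : H →ₗ.[ℂ] H, IsMAccretiveSqrt B† R) ∧
        (∀ S R : H →ₗ.[ℂ] H, IsMAccretiveSqrt B S → IsMAccretiveSqrt B† R →
          S.domain ≠ R.domain ∧
          R.toFun.ker = ⊥ ∧
          ∀ F : H →ₗ.[ℂ] H, F = prod S R.inverse →
            IsMAccretive F ∧ HasZeroRealPart F ∧ F.domain < F†.domain) ∧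
        (M ⊓ Q.range = ⊥ → B.domain ⊓ B†.domain = ⊥)) ∧
      -- the family is countably infinite: its members are pairwise distinct
      Set.InjOn (katoOp Q Z) {n : ℕ | 1 ≤ n} := by
  obtain ⟨K, hsqrt, hQK, hK, hKK⟩ := exists_isometric_factor hQ hQker M hMQ
  have hpair : ∀ n, IsSkewPair Q ((Complex.I • K) ^ (2 * n + 1)) :=
    isSkewPair_pow hQ hQker hM hQK hK hKK
  have hpow := pow_apply_mem hK hKK
  refine ⟨K, Complex.I • K, ofBounded_eq_quotientOp hQker hsqrt, rfl, ?_, ?_,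
    (injective_katoOp hpair).injOn⟩
  · rintro n - T hT
    have h := hpair n
    have hT' : T = Q * (1 + (Complex.I • K) ^ (2 * n + 1)) := hT
    have hQc : T = Q + ((-1) ^ n * Complex.I) • (Q * K ^ (2 * n + 1)) := by
      rw [hT', I_smul_pow, mul_add, mul_one, mul_smul_comm]
    have hsq : T ^ 2 = squareOp Q (Complex.I • K) n := by
      rw [squareOp_eq h, sq, hT']
    rw [← star_pow]
    refine ⟨hT'.trans h.root_eq, hQc, ?_⟩
    clear hQc hT
    subst hT'
    rw [sq, sq]
    rw [sq] at hsq
    exact ⟨h.isSectorialWith_root, h.root_add_star, h.ker_root, h.ker_one_add,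
      h.ker_one_sub_star, h.range_root_ne, hsq, h.isAccretive_sq, h.not_isSectorial_sq,
      fun F hF => h.quotient_spec hF, fun hMM => h.range_sq_inf (hpow n) hMM⟩
  · rintro n - B hB
    have h := hpair n
    rw [katoOp, squareOp_eq h] at hB
    have hroot : IsMAccretiveSqrt B (ofBounded (rootOp Q (Complex.I • K) n)).inverse := by
      rw [hB]
      exact h.isMAccretiveSqrt_iff.2 rfl
    refine ⟨hroot.2.symm, ?_⟩
    subst hB
    refine ⟨h.isMAccretive_inverse_sq, h.not_isSectorial_inverse_sq, ?_, ?_, ?_, ?_⟩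
    · simp only [h.isMAccretiveSqrt_iff]
      exact ⟨_, rfl, fun _ => id⟩
    · simp only [h.isMAccretiveSqrt_adjoint_iff]
      exact ⟨_, rfl, fun _ => id⟩
    · intro S R hS hR
      rw [h.isMAccretiveSqrt_iff] at hS
      rw [h.isMAccretiveSqrt_adjoint_iff] at hR
      subst hS hR
      refine ⟨?_, ker_inverse_ofBounded h.ker_star_root, fun F hF => ?_⟩
      · rw [domain_inverse_ofBounded, domain_inverse_ofBounded]
        exact h.range_root_ne
      · rw [inverse_inverse_ofBounded h.ker_star_root] at hF
        exact h.quotient_spec hF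
    · intro hMM
      rw [h.adjoint_inverse_sq, domain_inverse_ofBounded, domain_inverse_ofBounded]
      exact h.range_sq_inf (hpow n) hMM
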